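/- For a function $a$ on $\mathbb{C}^2$ put $L(a)=\begin{pmatrix}1&0\\a&1\end{pmatrix}$ and $U(a)=\begin{pmatrix}1&a\\0&1\end{pmatrix}$. These are called elementary matrices; they are continuous (holomorphic) if $a:\mathbb{C}^2\to\mathbb{C}$ is continuous (holomorphic). Consider the Cohn matrix $$A(z,w)=\begin{pmatrix}1+zw & z^2\\ -w^2 & 1-zw\end{pmatrix},\qquad (z,w)\in\mathbb{C}^2,$$ which takes values in $\mathrm{SL}_2(\mathbb{C})$. **Proposition.** 1. $A$ is a product of $4$ continuous elementary matrices, and it is not a product of fewer than $4$ continuous elementary matrices (of types $L$, $U$ in any order). 2. $A$ is a product of $5$ holomorphic elementary matrices, and it is not a product of fewer than $5$ holomorphic elementary matrices (of types $L$, $U$ in any order). 3. In every factorization $A=E_1(g_1)E_2(g_2)E_3(g_3)E_4(g_4)$ with $E_j\in\{L,U\}$ and continuous $g_j:\mathbb{C}^2\to\mathbb{C}$, the types of the factors alternate ($LULU$ or $ULUL$), and the factorization meets the singularity set $S_4=\{(\zeta_1,0,0,\zeta_4):\zeta_1,\zeta_4\in\mathbb{C}\}\subset\mathbb{C}^4$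 of the fibration $(\zeta_1,\dots,\zeta_4)\mapsto E_1(\zeta_1)E_2(\zeta_2)E_3(\zeta_3)E_4(\zeta_4)\in\mathrm{SL}_2(\mathbb{C})$. That is, there is a point $(z,w)\in\mathbb{C}^2$ with $(g_1(z,w),g_2(z,w),g_3(z,w),g_4(z,w))\in S_4$. -/

import Mathlib

open Matrix

/-- The two shapes of `2 × 2` elementary (unipotent) matrices. -/
inductive Shape where
  | lower
  | upper

/-- The elementary matrix of the given shape with entry `a`: `L(a) = (1, 0; a, 1)` or
`U(a) = (1, a; 0, 1)`. -/
def elementaryMatrix {R : Type*} [CommRing R] (s : Shape) (a : R) :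
    SpecialLinearGroup (Fin 2) R :=
  match s with
  | Shape.lower => ⟨!![1, 0; a, 1], by simp [Matrix.det_fin_two_of]⟩
  | Shape.upper => ⟨!![1, a; 0, 1], by simp [Matrix.det_fin_two_of]⟩

/-- The map `ℂ^N → SL₂(ℂ)`, `v ↦ E₁(v₁) E₂(v₂) ⋯ E_N(v_N)`, where `E_j` is the elementary matrix
of shape `σ j`. For the shapes `lower, upper, lower, …` this is the map `Φ_N`. -/
def elementaryProduct {N : ℕ} (σ : Fin N → Shape) (v : Fin N → ℂ) :
    SpecialLinearGroup (Fin 2) ℂ :=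
  (List.ofFn fun j => elementaryMatrix (σ j) (v j)).prod

/-- Lower and upper triangular factors alternate. -/
def Alternating {N : ℕ} (σ : Fin N → Shape) : Prop :=
  ∀ i j : Fin N, (i : ℕ) + 1 = (j : ℕ) → σ i ≠ σ j

/-- The singularity set `S_N = {(z₁, 0, …, 0, z_N)} ⊆ ℂ^N`. -/
def singularitySet (N : ℕ) : Set (Fin N → ℂ) :=
  {v | ∀ j : Fin N, 0 < (j : ℕ) → (j : ℕ) + 1 < N → v j = 0}

/-- The Cohn matrix, as a map `ℂ² → SL₂(ℂ)`. -/
def cohnMatrix (p : ℂ × ℂ) : SpecialLinearGroup (Fin 2) ℂ :=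
  ⟨!![1 + p.1 * p.2, p.1 ^ 2; -p.2 ^ 2, 1 - p.1 * p.2], by
    rw [Matrix.det_fin_two_of]; ring⟩

/-- `F = E₁(g₁) E₂(g₂) ⋯ E_N(g_N)` is a factorization of `F : ℂ² → SL₂(ℂ)` into elementary
matrices of shapes `σ` whose entries `g_j` belong to the class `𝓕` of functions on `ℂ²`. -/
def IsFactorization (𝓕 : Set (ℂ × ℂ → ℂ)) (F : ℂ × ℂ → SpecialLinearGroup (Fin 2) ℂ) {N : ℕ}
    (σ : Fin N → Shape) (g : Fin N → ℂ × ℂ → ℂ) : Prop :=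
  (∀ j, g j ∈ 𝓕) ∧ ∀ p, F p = elementaryProduct σ (fun j => g j p)

/-- The continuous functions on `ℂ²`. -/
def continuousFunctions : Set (ℂ × ℂ → ℂ) := {h | Continuous h}

/-- The holomorphic functions on `ℂ²`. -/
def holomorphicFunctions : Set (ℂ × ℂ → ℂ) := {h | Differentiable ℂ h}

/-- The numbers `N` such that `F` is a product of `N` elementary matrices with entries in `𝓕`;
the shapes of the factors are arbitrary. -/
def factorizationLengths (𝓕 : Set (ℂ × ℂ → ℂ)) (F : ℂ × ℂ → SpecialLinearGroup (Fin 2) ℂ) :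
    Set ℕ :=
  {N | ∃ (σ : Fin N → Shape) (g : Fin N → ℂ × ℂ → ℂ), IsFactorization 𝓕 F σ g}

/-! Comparing matrix entries, an `LULU` factorization has inner entries `Q`, `P` with `PQ = zw`,
equal to `z²` and `-w²` on the curve `1 + zw = 0`; the `ULUL` case is the same after `z ↦ -z`.
Adjacent factors of one shape merge, and three factors would force a continuous function to equal
`±1/z` near `0`, so four factors must alternate.

If `P` and `Q` had no common zero, one of them would vanish on the connected set `zw = 0` and the
other nowhere. A nowhere vanishing function on `ℂ²` has a logarithm, hence winding number zero on
the loop `(e^{it}, -e^{-it})`, whereas `z²` and `-w²` wind `±2` times (`exists_common_zero`).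

In the holomorphic case the common zero is the origin. On each axis one factor vanishes. If the same
factor vanishes on both, its derivative at `0` is zero, contradicting `PQ = zw` to second order;
otherwise the factor vanishing on `z = 0` is `z` times a nowhere vanishing function of winding
number `-3` or `1`.

The factorizations of lengths five and four are explicit. -/

/-! ### Winding numbers and continuous factors of `zw` -/

theorem exists_continuous_exp_eq {f : ℂ × ℂ → ℂ} (hf : Continuous f) (h0 : ∀ p, f p ≠ 0) :
    ∃ g : ℂ × ℂ → ℂ, Continuous g ∧ ∀ p, Complex.exp (g p) = f p := by
  obtain ⟨g, ⟨-, hg⟩, -⟩ := Complex.isCoveringMapOn_exp.existsUnique_continuousMap_lifts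
    ⟨f, hf⟩ (a₀ := 0) (Complex.exp_log (h0 0)) h0
  exact ⟨g, g.continuous, fun p => congrFun hg p⟩

/-- A nowhere vanishing continuous function on `ℂ²` has winding number zero along the loop
`t ↦ (e^{it}, -e^{-it})` in the curve `1 + zw = 0`. -/
theorem winding_eq_zero {f : ℂ × ℂ → ℂ} (hf : Continuous f) (h0 : ∀ p, f p ≠ 0) {c : ℂ} {k : ℤ}
    (h : ∀ u v : ℂ, u * v = 1 → f (u, -v) = c * u ^ k) : k = 0 := by
  obtain ⟨g, hg, hgf⟩ := exists_continuous_exp_eq hf h0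
  have hexp : IsLocallyInjective Complex.exp := fun z => by
    obtain ⟨e, hz, he⟩ := Complex.isCoveringMapOn_exp.isLocalHomeomorphOn z
      z.exp_ne_zero
    exact ⟨e.source, e.open_source, hz, he ▸ e.injOn⟩
  have hloop (t : ℝ) : f (Complex.exp (t * Complex.I), -Complex.exp (-(t * Complex.I))) =
      c * Complex.exp (k * (t * Complex.I)) := by
    rw [h _ _ (by rw [← Complex.exp_add]; simp), Complex.exp_int_mul]
  -- Both sides lift the same loop through `exp` and agree at `t = 0`. At `t = 2π` the loop closes
  -- up, leaving `2πik = 0`.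
  have key := (T2Space.isSeparatedMap Complex.exp).eq_of_comp_eq hexp (A := ℝ)
    (g₁ := fun t => g (Complex.exp (t * Complex.I), -Complex.exp (-(t * Complex.I))))
    (g₂ := fun t => k * (t * Complex.I) + g (1, -1)) (by fun_prop) (by fun_prop)
    (by
      funext t
      have h1 := hloop 0
      simp only [Complex.ofReal_zero, zero_mul, neg_zero, Complex.exp_zero, mul_zero,
        mul_one] at h1
      simp only [Function.comp_apply, hgf, hloop, Complex.exp_add, h1]
      ring) 0 (by simp)
  have h2 := congrFun key (2 * Real.pi)
  have h3 : Complex.exp (-(2 * Real.pi * Complex.I)) = 1 := by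
    rw [Complex.exp_neg, Complex.exp_two_pi_mul_I, inv_one]
  simp only [Complex.ofReal_mul, Complex.ofReal_ofNat, Complex.exp_two_pi_mul_I, h3] at h2
  have h4 : (k : ℂ) * (2 * Real.pi * Complex.I) = 0 := by linear_combination -h2
  simpa [Complex.I_ne_zero, Real.pi_ne_zero] using h4

/-- The two zero sets are closed, cover `S` and are disjoint on it. -/
theorem IsPreconnected.forall_eq_zero_or_forall_eq_zero {X : Type*} [TopologicalSpace X]
    {S : Set X} (hS : IsPreconnected S) {f g : X → ℂ} (hf : Continuous f) (hg : Continuous g)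
    (hfg : ∀ x ∈ S, f x * g x = 0) (hne : ∀ x ∈ S, f x = 0 → g x ≠ 0) :
    (∀ x ∈ S, f x = 0) ∨ ∀ x ∈ S, g x = 0 := by
  refine isPreconnected_iff_subset_of_disjoint_closed.1 hS {x | f x = 0} {x | g x = 0}
    (isClosed_eq hf continuous_const) (isClosed_eq hg continuous_const)
    (fun x hx => mul_eq_zero.1 (hfg x hx)) ?_
  ext x
  simp only [Set.mem_inter_iff, Set.mem_ofPred_eq, Set.mem_empty_iff_false, iff_false]
  exact fun ⟨hx, h1, h2⟩ => hne x hx h1 h2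

theorem isPreconnected_coordinate_axes : IsPreconnected {p : ℂ × ℂ | p.1 * p.2 = 0} := by
  have h : {p : ℂ × ℂ | p.1 * p.2 = 0} =
      (fun z : ℂ => ((0 : ℂ), z)) '' Set.univ ∪ (fun z : ℂ => (z, (0 : ℂ))) '' Set.univ := by
    ext ⟨z, w⟩
    simp [eq_comm]
  rw [h]
  exact (isPreconnected_univ.image _ (by fun_prop)).union (0, 0) ⟨0, trivial, rfl⟩
    ⟨0, trivial, rfl⟩ (isPreconnected_univ.image _ (by fun_prop))

/-- Continuous `P`, `Q` with `PQ = zw` whose restrictions to the curve `1 + zw = 0` are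
`-w²` and `z²` have a common zero. -/
theorem exists_common_zero {P Q : ℂ × ℂ → ℂ} (hP : Continuous P) (hQ : Continuous Q)
    (hPQ : ∀ p, P p * Q p = p.1 * p.2) (hPc : ∀ u v : ℂ, u * v = 1 → P (u, -v) = -v ^ 2)
    (hQc : ∀ u v : ℂ, u * v = 1 → Q (u, -v) = u ^ 2) : ∃ p, P p = 0 ∧ Q p = 0 := by
  by_contra! hne
  rcases isPreconnected_coordinate_axes.forall_eq_zero_or_forall_eq_zero hP hQ
    (fun p hp => (hPQ p).trans hp) (fun p _ => hne p) with h | h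
  · have hQ0 (p) : Q p ≠ 0 := fun hp =>
      hne p (h p (by simpa [hp] using (hPQ p).symm)) hp
    simpa using winding_eq_zero hQ hQ0 (c := 1) (k := 2)
      fun u v huv => by rw [hQc u v huv]; norm_cast; simp
  · have hP0 (p) : P p ≠ 0 := fun hp =>
      hne p hp (h p (by simpa [hp] using (hPQ p).symm))
    simpa using winding_eq_zero hP hP0 (c := -1) (k := -2)
      fun u v huv => by
        rw [hPc u v huv, eq_inv_of_mul_eq_one_right huv, _root_.zpow_neg, inv_pow]; norm_cast; simp

/-! ### Holomorphic factors of `zw` -/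

/-- Division by the first coordinate of a holomorphic function is continuous. -/
theorem continuous_dslope_fst {P : ℂ × ℂ → ℂ} (hP : Differentiable ℂ P) :
    Continuous fun p : ℂ × ℂ => dslope (fun z => P (z, p.2)) 0 p.1 := by
  rw [continuous_iff_continuousAt]
  intro p₀
  set ρ : ℝ := ‖p₀.1‖ + 1 with hρ
  have hρ0 : 0 < ρ := by positivity
  set V : Set (ℂ × ℂ) := {p | ‖p.1‖ < ρ} with hV
  have hVo : IsOpen V := isOpen_lt (by fun_prop) (by fun_prop)
  have hmem : p₀ ∈ V := by simp [hV, hρ]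
  refine ContinuousOn.continuousAt ?_ (hVo.mem_nhds hmem)
  rw [continuousOn_iff_continuous_domRestrict]
  -- On a circle around `0` enclosing the point, Cauchy's formula expresses the quotient by its
  -- boundary values, where division by `ζ` is harmless; the integral is continuous in the
  -- parameters.
  have hcauchy (p : V) : dslope (fun z => P (z, p.1.2)) 0 p.1.1 =
      (2 * Real.pi * Complex.I : ℂ)⁻¹ • ∮ ζ in C(0, ρ),
        (ζ - p.1.1)⁻¹ • ((P (ζ, p.1.2) - P (0, p.1.2)) / ζ) := by
    have hd : Differentiable ℂ (dslope (fun z => P (z, p.1.2)) 0) := by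
      rw [← differentiableOn_univ, Complex.differentiableOn_dslope Filter.univ_mem]
      exact (hP.comp (differentiable_id.prodMk (differentiable_const _))).differentiableOn
    rw [← hd.diffContOnCl.two_pi_i_inv_smul_circleIntegral_sub_inv_smul
      (c := 0) (R := ρ) (by simpa using show ‖p.1.1‖ < ρ from p.2)]
    congr 1
    refine circleIntegral.integral_congr hρ0.le fun ζ hζ => ?_
    have hζ0 : ζ ≠ 0 := by rintro rfl; simp at hζ; exact hρ0.ne hζ
    simp only [dslope_of_ne _ hζ0, slope_def_field, sub_zero]
  have hfun : V.domRestrict (fun p : ℂ × ℂ => dslope (fun z => P (z, p.2)) 0 p.1) = _ :=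
    funext hcauchy
  rw [hfun]
  simp only [smul_eq_mul, circleIntegral]
  refine continuous_const.mul ?_
  refine intervalIntegral.continuous_parametric_intervalIntegral_of_continuous' ?_ _ _
  have hPc := hP.continuous
  simp only [Function.uncurry_def, deriv_circleMap]
  have h1 : ∀ x : V × ℝ, circleMap 0 ρ x.2 ≠ 0 := fun x => circleMap_ne_center hρ0.ne'
  have h2 : ∀ x : V × ℝ, circleMap 0 ρ x.2 - x.1.1.1 ≠ 0 := fun x h => by
    have h3 : ‖x.1.1.1‖ < ρ := x.1.2
    rw [← sub_eq_zero.1 h] at h3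
    simp [abs_of_pos hρ0] at h3
  have h4 : Continuous fun x : V × ℝ => circleMap 0 ρ x.2 := by fun_prop
  have h5 : Continuous fun x : V × ℝ => (circleMap 0 ρ x.2 - x.1.1.1)⁻¹ :=
    Continuous.inv₀ (by fun_prop) h2
  have h6 : Continuous fun x : V × ℝ =>
      (P (circleMap 0 ρ x.2, x.1.1.2) - P (0, x.1.1.2)) / circleMap 0 ρ x.2 :=
    Continuous.div (by fun_prop) h4 h1
  fun_prop

section CommonZeros

variable {P Q : ℂ × ℂ → ℂ} (hP : Differentiable ℂ P) (hQ : Differentiable ℂ Q)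
  (hPQ : ∀ p, P p * Q p = p.1 * p.2)

theorem Differentiable.hasDerivAt_line (hP : Differentiable ℂ P) (p v : ℂ × ℂ) :
    HasDerivAt (fun t : ℂ => P (p + t • v)) (fderiv ℂ P p v) 0 := by
  have h1 : HasDerivAt (fun t : ℂ => p + t • v) v 0 := by
    simpa using ((hasDerivAt_id (0 : ℂ)).smul_const v).const_add p
  have h2 : HasFDerivAt P (fderiv ℂ P p) (p + (0 : ℂ) • v) := by
    simpa using (hP p).hasFDerivAt
  exact h2.comp_hasDerivAt 0 h1

include hP hQ hPQ

theorem fderiv_leibniz_coordinate_product (p v : ℂ × ℂ) :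
    fderiv ℂ P p v * Q p + P p * fderiv ℂ Q p v = v.1 * p.2 + p.1 * v.2 := by
  have h1 := (hP.hasDerivAt_line p v).mul (hQ.hasDerivAt_line p v)
  have h2 : HasDerivAt (fun t : ℂ => (p.1 + t * v.1) * (p.2 + t * v.2))
      (v.1 * p.2 + p.1 * v.2) 0 := by
    have h3 := (((hasDerivAt_id (0 : ℂ)).mul_const v.1).const_add p.1).mul
      (((hasDerivAt_id (0 : ℂ)).mul_const v.2).const_add p.2)
    simp only [id_eq, zero_mul, add_zero, one_mul] at h3
    exact h3
  have h4 : ((fun t : ℂ => P (p + t • v)) * fun t : ℂ => Q (p + t • v)) =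
      fun t : ℂ => (p.1 + t * v.1) * (p.2 + t * v.2) := by
    funext t
    simp [hPQ]
  rw [h4] at h1
  simpa using h1.unique h2

/-- By the Leibniz rule `d(zw) = w dz + z dw` vanishes at a common zero. -/
theorem common_zero_eq_zero {p : ℂ × ℂ} (h1 : P p = 0) (h2 : Q p = 0) : p = 0 := by
  have h3 := fderiv_leibniz_coordinate_product hP hQ hPQ p (1, 0)
  have h4 := fderiv_leibniz_coordinate_product hP hQ hPQ p (0, 1)
  simp only [h1, h2, mul_zero, zero_mul, add_zero, one_mul, mul_one, zero_add] at h3 h4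
  exact Prod.ext h4.symm h3.symm

/-- On the diagonal `P(t,t) Q(t,t) = t²`; divide by `t²` and let `t → 0`. -/
theorem fderiv_mul_fderiv_of_common_zero (h1 : P 0 = 0) (h2 : Q 0 = 0) :
    fderiv ℂ P 0 (1, 1) * fderiv ℂ Q 0 (1, 1) = 1 := by
  have hp := (hasDerivAt_iff_tendsto_slope.1 (hP.hasDerivAt_line 0 (1, 1))).mul
    (hasDerivAt_iff_tendsto_slope.1 (hQ.hasDerivAt_line 0 (1, 1)))
  refine tendsto_nhds_unique hp (tendsto_const_nhds.congr' ?_)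
  filter_upwards [self_mem_nhdsWithin] with t ht
  have ht' : t ≠ 0 := ht
  have := hPQ (t, t)
  have h1' : P (0, 0) = 0 := h1
  have h2' : Q (0, 0) = 0 := h2
  simp only [slope_def_field, zero_add, sub_zero, Prod.smul_mk, smul_eq_mul, mul_one, h1', h2']
  field_simp
  linear_combination -this

/-- If `PQ = zw`, `P` vanishes for `z = 0` and `Q` vanishes for `w = 0`, then `P` is `z` times
a nowhere vanishing function. -/
theorem exists_continuous_ne_zero_of_eq_fst_mul (hP0 : ∀ w, P (0, w) = 0)
    (hQ0 : ∀ z, Q (z, 0) = 0) :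
    ∃ R : ℂ × ℂ → ℂ, Continuous R ∧ (∀ p, R p ≠ 0) ∧ ∀ p, P p = p.1 * R p := by
  have hmul (p : ℂ × ℂ) : P p = p.1 * dslope (fun z => P (z, p.2)) 0 p.1 := by
    have := sub_smul_dslope (fun z => P (z, p.2)) 0 p.1
    simpa [hP0] using this.symm
  refine ⟨_, continuous_dslope_fst hP, ?_, hmul⟩
  rintro ⟨z, w⟩ hR
  -- On `z = 0` the quotient is `∂P/∂z`, and its vanishing contradicts the Leibniz rule if `w ≠ 0`
  -- and the second-order identity at the origin. Off `z = 0`, a zero would be a common zero of `P`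
  -- and `Q` other than the origin.
  by_cases hz : z = 0
  · subst hz
    have hd : fderiv ℂ P (0, w) (1, 0) = 0 := by
      rw [← (hP.hasDerivAt_line (0, w) (1, 0)).deriv]
      simpa using hR
    by_cases hw : w = 0
    · subst hw
      have h1 := fderiv_mul_fderiv_of_common_zero hP hQ hPQ (hP0 0) (hQ0 0)
      have h2 : fderiv ℂ P 0 (0, 1) = 0 := by
        rw [← (hP.hasDerivAt_line 0 (0, 1)).deriv]
        simp [hP0]
      have h3 : fderiv ℂ P 0 (1, 1) = 0 := by
        rw [show ((1 : ℂ), (1 : ℂ)) = (1, 0) + (0, 1) by simp, map_add, h2, add_zero]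
        exact hd
      simp [h3] at h1
    · have h1 := fderiv_leibniz_coordinate_product hP hQ hPQ (0, w) (1, 0)
      simp [hd, hP0] at h1
      exact hw h1.symm
  · have hPz : P (z, w) = 0 := by rw [hmul, hR, mul_zero]
    have hw : w = 0 := by simpa [hPz, hz] using (hPQ (z, w)).symm
    subst hw
    have := common_zero_eq_zero hP hQ hPQ hPz (hQ0 z)
    exact hz (congrArg Prod.fst this)

/-- A function vanishing on both axes has vanishing derivative at the origin, which is impossible
for a factor of `zw` if both factors vanish there. -/
theorem not_vanish_on_axes (hP0 : ∀ w, P (0, w) = 0) (hP1 : ∀ z, P (z, 0) = 0)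
    (hQ0 : Q 0 = 0) : False := by
  have h1 := fderiv_mul_fderiv_of_common_zero hP hQ hPQ (hP0 0) hQ0
  have h2 : fderiv ℂ P 0 (0, 1) = 0 := by
    rw [← (hP.hasDerivAt_line 0 (0, 1)).deriv]
    simp [hP0]
  have h3 : fderiv ℂ P 0 (1, 0) = 0 := by
    rw [← (hP.hasDerivAt_line 0 (1, 0)).deriv]
    simp [hP1]
  have h4 : fderiv ℂ P 0 (1, 1) = 0 := by
    rw [show ((1 : ℂ), (1 : ℂ)) = (1, 0) + (0, 1) by simp, map_add, h2, h3, add_zero]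
  simp [h4] at h1

/-- The punctured line is connected and, away from the origin, carries no common zero. -/
theorem vanish_on_line {e : ℂ → ℂ × ℂ} (he : Continuous e) (he0 : e 0 = 0)
    (hne : ∀ t, t ≠ 0 → e t ≠ 0) (hprod : ∀ t, (e t).1 * (e t).2 = 0) (h1 : P 0 = 0)
    (h2 : Q 0 = 0) : (∀ t, P (e t) = 0) ∨ ∀ t, Q (e t) = 0 := by
  have hS : IsPreconnected ({0}ᶜ : Set ℂ) :=
    (isConnected_compl_singleton_of_one_lt_rank
      (by rw [Complex.rank_real_complex]; exact_mod_cast one_lt_two) 0).isPreconnected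
  have hext {f : ℂ × ℂ → ℂ} (hf : f 0 = 0) (h : ∀ t ∈ ({0}ᶜ : Set ℂ), f (e t) = 0) (t : ℂ) :
      f (e t) = 0 := by
    by_cases ht : t = 0
    · rw [ht, he0, hf]
    · exact h t ht
  exact (hS.forall_eq_zero_or_forall_eq_zero (hP.continuous.comp he) (hQ.continuous.comp he)
    (fun t _ => (hPQ _).trans (hprod t))
    (fun t ht hp hq => hne t ht (common_zero_eq_zero hP hQ hPQ hp hq))).imp (hext h1) (hext h2)

/-- There are no holomorphic `P`, `Q` with `PQ = zw` whose restrictions to the curve `1 + zw = 0`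
are `-w²` and `z²`. -/
theorem not_holomorphic_of_mul_eq (hPc : ∀ u v : ℂ, u * v = 1 → P (u, -v) = -v ^ 2)
    (hQc : ∀ u v : ℂ, u * v = 1 → Q (u, -v) = u ^ 2) : False := by
  obtain ⟨p, h1, h2⟩ := exists_common_zero hP.continuous hQ.continuous hPQ hPc hQc
  obtain rfl := common_zero_eq_zero hP hQ hPQ h1 h2
  have hQP (p) : Q p * P p = p.1 * p.2 := by rw [mul_comm, hPQ]
  have hz := vanish_on_line hP hQ hPQ (e := fun t => (0, t)) (by fun_prop) rfl
    (fun t ht h => ht (congrArg Prod.snd h)) (by simp) h1 h2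
  have hw := vanish_on_line hP hQ hPQ (e := fun t => (t, 0)) (by fun_prop) rfl
    (fun t ht h => ht (congrArg Prod.fst h)) (by simp) h1 h2
  have hu {u v : ℂ} (huv : u * v = 1) : u ≠ 0 := left_ne_zero_of_mul_eq_one huv
  rcases hz with hz | hz <;> rcases hw with hw | hw
  · exact not_vanish_on_axes hP hQ hPQ hz hw h2
  · obtain ⟨R, hR, hR0, hRP⟩ := exists_continuous_ne_zero_of_eq_fst_mul hP hQ hPQ hz hw
    -- On the curve `R = P/z = -v²/u = -u⁻³`.
    have h := winding_eq_zero hR hR0 (c := -1) (k := -3) fun u v huv => by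
      have h3 := hRP (u, -v)
      have h4 : u ^ (-3 : ℤ) = v ^ 3 := by
        rw [_root_.zpow_neg, eq_inv_of_mul_eq_one_right huv]
        norm_cast
        simp
      rw [hPc u v huv] at h3
      rw [h4]
      linear_combination (-R (u, -v)) * huv - v * h3
    simp at h
  · obtain ⟨R, hR, hR0, hRQ⟩ := exists_continuous_ne_zero_of_eq_fst_mul hQ hP hQP hz hw
    have h := winding_eq_zero hR hR0 (c := 1) (k := 1) fun u v huv => by
      have h3 := hRQ (u, -v)
      rw [hQc u v huv] at h3
      have h4 : u * (u - R (u, -v)) = 0 := by linear_combination h3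
      rw [one_mul, zpow_one]
      exact (sub_eq_zero.1 ((mul_eq_zero.1 h4).resolve_left (hu huv))).symm
    simp at h
  · exact not_vanish_on_axes hQ hP hQP hz hw h1

end CommonZeros

/-! ### Elementary matrices and entry relations -/

theorem coe_elementaryMatrix_lower {R : Type*} [CommRing R] (a : R) :
    (elementaryMatrix .lower a : Matrix (Fin 2) (Fin 2) R) = !![1, 0; a, 1] := rfl

theorem coe_elementaryMatrix_upper {R : Type*} [CommRing R] (a : R) :
    (elementaryMatrix .upper a : Matrix (Fin 2) (Fin 2) R) = !![1, a; 0, 1] := rfl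

theorem coe_cohnMatrix (p : ℂ × ℂ) : (cohnMatrix p : Matrix (Fin 2) (Fin 2) ℂ) =
    !![1 + p.1 * p.2, p.1 ^ 2; -p.2 ^ 2, 1 - p.1 * p.2] := rfl

theorem elementaryMatrix_mul_same {R : Type*} [CommRing R] (s : Shape) (a b : R) :
    elementaryMatrix s a * elementaryMatrix s b = elementaryMatrix s (a + b) := by
  cases s <;> ext i j <;> fin_cases i <;> fin_cases j <;>
    simp [coe_elementaryMatrix_lower, coe_elementaryMatrix_upper, add_comm]

theorem elementaryMatrix_zero {R : Type*} [CommRing R] (s : Shape) :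
    elementaryMatrix s (0 : R) = 1 := by
  cases s <;> ext i j <;> fin_cases i <;> fin_cases j <;> simp [elementaryMatrix]

theorem elementaryProduct_four (σ : Fin 4 → Shape) (v : Fin 4 → ℂ) :
    elementaryProduct σ v = elementaryMatrix (σ 0) (v 0) * elementaryMatrix (σ 1) (v 1) *
      elementaryMatrix (σ 2) (v 2) * elementaryMatrix (σ 3) (v 3) := by
  simp [elementaryProduct, List.ofFn_succ, mul_assoc]

theorem elementaryProduct_five (σ : Fin 5 → Shape) (v : Fin 5 → ℂ) :
    elementaryProduct σ v = elementaryMatrix (σ 0) (v 0) * elementaryMatrix (σ 1) (v 1) *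
      elementaryMatrix (σ 2) (v 2) * elementaryMatrix (σ 3) (v 3) *
      elementaryMatrix (σ 4) (v 4) := by
  simp [elementaryProduct, List.ofFn_succ, mul_assoc]

/-- The relations between the entries in a factorization of shape `LULU`. -/
theorem relations_of_cohnMatrix_eq_LULU {p : ℂ × ℂ} {a b c d : ℂ}
    (h : cohnMatrix p = elementaryMatrix .lower a * elementaryMatrix .upper b *
      elementaryMatrix .lower c * elementaryMatrix .upper d) :
    c * b = p.1 * p.2 ∧ b = p.1 ^ 2 - d * (1 + p.1 * p.2) ∧
      c = -p.2 ^ 2 - a * (1 + p.1 * p.2) := by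
  have h00 := congrArg (fun M : SpecialLinearGroup (Fin 2) ℂ => (M : Matrix (Fin 2) (Fin 2) ℂ) 0 0) h
  have h01 := congrArg (fun M : SpecialLinearGroup (Fin 2) ℂ => (M : Matrix (Fin 2) (Fin 2) ℂ) 0 1) h
  have h10 := congrArg (fun M : SpecialLinearGroup (Fin 2) ℂ => (M : Matrix (Fin 2) (Fin 2) ℂ) 1 0) h
  simp [coe_cohnMatrix, coe_elementaryMatrix_lower, coe_elementaryMatrix_upper] at h00 h01 h10
  refine ⟨by linear_combination -h00, ?_, ?_⟩
  · linear_combination -h01 + d * h00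
  · linear_combination -h10 + a * h00

/-- The relations between the entries in a factorization of shape `ULUL`. -/
theorem relations_of_cohnMatrix_eq_ULUL {p : ℂ × ℂ} {a b c d : ℂ}
    (h : cohnMatrix p = elementaryMatrix .upper a * elementaryMatrix .lower b *
      elementaryMatrix .upper c * elementaryMatrix .lower d) :
    b * c = -(p.1 * p.2) ∧ c = p.1 ^ 2 - a * (1 - p.1 * p.2) ∧
      b = -p.2 ^ 2 - d * (1 - p.1 * p.2) := by
  have h01 := congrArg (fun M : SpecialLinearGroup (Fin 2) ℂ => (M : Matrix (Fin 2) (Fin 2) ℂ) 0 1) h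
  have h10 := congrArg (fun M : SpecialLinearGroup (Fin 2) ℂ => (M : Matrix (Fin 2) (Fin 2) ℂ) 1 0) h
  have h11 := congrArg (fun M : SpecialLinearGroup (Fin 2) ℂ => (M : Matrix (Fin 2) (Fin 2) ℂ) 1 1) h
  simp [coe_cohnMatrix, coe_elementaryMatrix_lower, coe_elementaryMatrix_upper] at h01 h10 h11
  have h : b * c = -(p.1 * p.2) := by linear_combination -h11
  refine ⟨h, ?_, ?_⟩
  · linear_combination -h01 - a * h
  · linear_combination -h10 - d * h

/-- The outer entries determine the inner ones; the single equation left for `x`, `y` comes from the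
lower right entry. -/
theorem cohnMatrix_eq_LULU {p : ℂ × ℂ} {x y : ℂ}
    (h : (1 + p.1 * p.2) * (x * y) = p.1 * p.2 + x * p.1 ^ 2 - y * p.2 ^ 2) :
    cohnMatrix p = elementaryMatrix .lower x *
      elementaryMatrix .upper (p.1 ^ 2 - y * (1 + p.1 * p.2)) *
      elementaryMatrix .lower (-p.2 ^ 2 - x * (1 + p.1 * p.2)) * elementaryMatrix .upper y := by
  have h00 : (p.1 ^ 2 - y * (1 + p.1 * p.2)) * (-p.2 ^ 2 - x * (1 + p.1 * p.2)) = p.1 * p.2 := by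
    linear_combination (1 + p.1 * p.2) * h
  ext i j
  fin_cases i <;> fin_cases j <;> 
    simp [coe_cohnMatrix, coe_elementaryMatrix_lower, coe_elementaryMatrix_upper]
  · linear_combination -h00
  · linear_combination -y * h00
  · linear_combination -x * h00
  · linear_combination -x * y * h00 + h

/-! ### Three factors do not suffice; alternation -/

theorem mul_continuous_ne_const {f : ℂ → ℂ} (hf : Continuous f) {k : ℂ} (hk : k ≠ 0)
    (h : ∀ z, z ≠ 0 → z * f z = k) : False := by
  have h1 : Filter.Tendsto (fun z : ℂ => z * f z) (nhdsWithin 0 {0}ᶜ) (nhds (0 * f 0)) :=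
    ((continuous_id.mul hf).tendsto 0).mono_left nhdsWithin_le_nhds
  have h2 : Filter.Tendsto (fun z : ℂ => z * f z) (nhdsWithin 0 {0}ᶜ) (nhds k) := by
    refine tendsto_const_nhds.congr' ?_
    filter_upwards [self_mem_nhdsWithin] with z hz
    exact (h z hz).symm
  exact hk (by simpa using tendsto_nhds_unique h2 h1)

theorem cohnMatrix_ne_LUL {a b c : ℂ × ℂ → ℂ} (hc : Continuous c)
    (h : ∀ p, cohnMatrix p = elementaryMatrix .lower (a p) * elementaryMatrix .upper (b p) *
      elementaryMatrix .lower (c p)) : False := by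
  refine mul_continuous_ne_const (f := fun z => c (z, 1)) (by fun_prop) one_ne_zero
    fun z hz => ?_
  have h1 := h (z, 1)
  -- A trivial fourth factor makes the `LULU` relations applicable; they give `z c(z,1) = 1` for `z
  -- ≠ 0`.
  rw [← mul_one (_ * _ * _), ← elementaryMatrix_zero .upper] at h1
  obtain ⟨h2, h3, -⟩ := relations_of_cohnMatrix_eq_LULU h1
  rw [h3] at h2
  have h4 : z * (z * c (z, 1) - 1) = 0 := by linear_combination h2
  exact sub_eq_zero.1 ((mul_eq_zero.1 h4).resolve_left hz)

theorem cohnMatrix_ne_ULU {a b c : ℂ × ℂ → ℂ} (ha : Continuous a)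
    (h : ∀ p, cohnMatrix p = elementaryMatrix .upper (a p) * elementaryMatrix .lower (b p) *
      elementaryMatrix .upper (c p)) : False := by
  refine mul_continuous_ne_const (f := fun w => a (1, w)) (by fun_prop) (neg_ne_zero.2 one_ne_zero)
    fun w hw => ?_
  have h1 := h (1, w)
  rw [← one_mul (_ * _ * _), ← elementaryMatrix_zero .lower, ← mul_assoc, ← mul_assoc] at h1
  obtain ⟨h2, -, h3⟩ := relations_of_cohnMatrix_eq_LULU h1
  rw [h3] at h2
  have h4 : w * (w * a (1, w) + 1) = 0 := by linear_combination -h2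
  linear_combination (mul_eq_zero.1 h4).resolve_left hw

theorem cohnMatrix_ne_three {s₁ s₂ s₃ : Shape} {a b c : ℂ × ℂ → ℂ} (ha : Continuous a)
    (hb : Continuous b) (hc : Continuous c)
    (h : ∀ p, cohnMatrix p = elementaryMatrix s₁ (a p) * elementaryMatrix s₂ (b p) *
      elementaryMatrix s₃ (c p)) : False := by
  have h0 : Continuous fun _ : ℂ × ℂ => (0 : ℂ) := continuous_const
  cases s₁ <;> cases s₂ <;> cases s₃
  · exact cohnMatrix_ne_LUL (a := fun p => a p + b p + c p) (b := 0) h0 fun p => by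
      simp [h p, elementaryMatrix_mul_same, elementaryMatrix_zero]
  · exact cohnMatrix_ne_LUL (a := fun p => a p + b p) (b := c) h0 fun p => by
      simp [h p, elementaryMatrix_mul_same, elementaryMatrix_zero]
  · exact cohnMatrix_ne_LUL hc h
  · exact cohnMatrix_ne_LUL (a := a) (b := fun p => b p + c p) h0 fun p => by
      simp [h p, elementaryMatrix_mul_same, elementaryMatrix_zero, mul_assoc]
  · exact cohnMatrix_ne_ULU (b := fun p => b p + c p) (c := 0) ha fun p => by
      simp [h p, elementaryMatrix_mul_same, elementaryMatrix_zero, mul_assoc]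
  · exact cohnMatrix_ne_ULU ha h
  · exact cohnMatrix_ne_ULU (b := c) (c := 0) (ha.add hb) fun p => by
      simp [h p, elementaryMatrix_mul_same, elementaryMatrix_zero]
  · exact cohnMatrix_ne_ULU (b := 0) (c := 0) ((ha.add hb).add hc) fun p => by
      simp [h p, elementaryMatrix_mul_same, elementaryMatrix_zero]

theorem alternating_of_isFactorization {σ : Fin 4 → Shape} {g : Fin 4 → ℂ × ℂ → ℂ}
    (h : IsFactorization continuousFunctions cohnMatrix σ g) : Alternating σ := by
  obtain ⟨hg, h⟩ := h
  replace hg (j) : Continuous (g j) := hg j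
  simp only [elementaryProduct_four] at h
  intro i j hij hs
  obtain ⟨rfl, rfl⟩ | ⟨rfl, rfl⟩ | ⟨rfl, rfl⟩ :
      (i = 0 ∧ j = 1) ∨ (i = 1 ∧ j = 2) ∨ (i = 2 ∧ j = 3) := by
    simp only [Fin.ext_iff]
    have := j.2
    simp
    omega
  · exact cohnMatrix_ne_three (s₁ := σ 1) (s₂ := σ 2) (s₃ := σ 3)
      ((hg 0).add (hg 1)) (hg 2) (hg 3) fun p => by
      rw [h, hs, elementaryMatrix_mul_same]; rfl
  · exact cohnMatrix_ne_three (s₁ := σ 0) (s₂ := σ 2) (s₃ := σ 3)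
      (hg 0) ((hg 1).add (hg 2)) (hg 3) fun p => by
      rw [h, hs, mul_assoc (elementaryMatrix (σ 0) _), elementaryMatrix_mul_same]; rfl
  · exact cohnMatrix_ne_three (s₁ := σ 0) (s₂ := σ 1) (s₃ := σ 3)
      (hg 0) (hg 1) ((hg 2).add (hg 3)) fun p => by
      rw [h, hs, mul_assoc, elementaryMatrix_mul_same]; rfl

theorem elementaryProduct_snoc_zero {N : ℕ} (σ : Fin N → Shape) (v : Fin N → ℂ) (s : Shape) :
    elementaryProduct (Fin.snoc σ s) (Fin.snoc v 0 : Fin (N + 1) → ℂ) = elementaryProduct σ v := by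
  simp only [elementaryProduct]
  rw [List.ofFn_succ', List.concat_eq_append, List.prod_append]
  simp [elementaryMatrix_zero]

theorem IsFactorization.snoc_zero {𝓕 : Set (ℂ × ℂ → ℂ)}
    {F : ℂ × ℂ → SpecialLinearGroup (Fin 2) ℂ} {N : ℕ} {σ : Fin N → Shape}
    {g : Fin N → ℂ × ℂ → ℂ} (h : IsFactorization 𝓕 F σ g) (h0 : (fun _ => 0) ∈ 𝓕) (s : Shape) :
    IsFactorization 𝓕 F (Fin.snoc σ s : Fin (N + 1) → Shape)
      (Fin.snoc g (fun _ => 0) : Fin (N + 1) → ℂ × ℂ → ℂ) := by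
  refine ⟨fun j => ?_, fun p => ?_⟩
  · induction j using Fin.lastCases with
    | last => simpa using h0
    | cast j => simpa using h.1 j
  · rw [h.2 p, ← elementaryProduct_snoc_zero σ _ s]
    congr 1
    funext j
    induction j using Fin.lastCases <;> simp

theorem factorizationLengths_succ {𝓕 : Set (ℂ × ℂ → ℂ)}
    {F : ℂ × ℂ → SpecialLinearGroup (Fin 2) ℂ} (h0 : (fun _ => 0) ∈ 𝓕) {N : ℕ}
    (h : N ∈ factorizationLengths 𝓕 F) : N + 1 ∈ factorizationLengths 𝓕 F :=
  let ⟨_, _, h⟩ := h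
  ⟨_, _, h.snoc_zero h0 .lower⟩

theorem factorizationLengths_of_le {𝓕 : Set (ℂ × ℂ → ℂ)}
    {F : ℂ × ℂ → SpecialLinearGroup (Fin 2) ℂ} (h0 : (fun _ => 0) ∈ 𝓕) {M N : ℕ} (hMN : M ≤ N)
    (h : M ∈ factorizationLengths 𝓕 F) : N ∈ factorizationLengths 𝓕 F :=
  Nat.le_induction h (fun _ _ => factorizationLengths_succ h0) N hMN

theorem four_le_of_mem_factorizationLengths {N : ℕ}
    (h : N ∈ factorizationLengths continuousFunctions cohnMatrix) : 4 ≤ N := by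
  by_contra! hN
  have h0 : (fun _ => 0) ∈ continuousFunctions := continuous_const
  obtain ⟨σ, g, h⟩ := factorizationLengths_of_le h0 (Nat.le_of_lt_succ hN) h
  -- Padding by a trivial factor of the same shape as the last one yields a non-alternating
  -- factorization of length four.
  refine alternating_of_isFactorization (h.snoc_zero h0 (σ 2)) 2 3 rfl ?_
  exact (Fin.snoc_castSucc (α := fun _ => Shape) (σ 2) σ 2).trans
    (Fin.snoc_last (α := fun _ => Shape) (σ 2) σ).symm

/-- The two inner entries of an alternating factorization of length four are, up to a sign change
of `z`, factors of `zw` with prescribed restrictions to the curve `1 + zw = 0`. -/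
theorem inner_entries_of_alternating {σ : Fin 4 → Shape} {g : Fin 4 → ℂ × ℂ → ℂ}
    (hσ : Alternating σ) (h : ∀ p, cohnMatrix p = elementaryProduct σ fun j => g j p) :
    ∃ (ε : ℂ) (i j : Fin 4), (i = 1 ∧ j = 2 ∨ i = 2 ∧ j = 1) ∧
      (∀ p : ℂ × ℂ, g i (ε * p.1, p.2) * g j (ε * p.1, p.2) = p.1 * p.2) ∧
      (∀ u v : ℂ, u * v = 1 → g i (ε * u, -v) = -v ^ 2) ∧
      ∀ u v : ℂ, u * v = 1 → g j (ε * u, -v) = u ^ 2 := by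
  simp only [elementaryProduct_four] at h
  have h01 := hσ 0 1 rfl
  have h12 := hσ 1 2 rfl
  have h23 := hσ 2 3 rfl
  cases h0 : σ 0 <;> cases h1 : σ 1 <;> cases h2 : σ 2 <;> cases h3 : σ 3 <;>
    simp [h0, h1, h2, h3] at h01 h12 h23 h
  · have hrel := fun p : ℂ × ℂ => relations_of_cohnMatrix_eq_LULU (h p.1 p.2)
    refine ⟨1, 2, 1, by simp, fun p => by simpa using (hrel p).1, fun u v huv => ?_,
      fun u v huv => ?_⟩
    · obtain ⟨-, -, hc⟩ := hrel (u, -v)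
      rw [one_mul, hc]
      linear_combination g 0 (u, -v) * huv
    · obtain ⟨-, hb, -⟩ := hrel (u, -v)
      rw [one_mul, hb]
      linear_combination g 3 (u, -v) * huv
  · have hrel := fun p : ℂ × ℂ => relations_of_cohnMatrix_eq_ULUL (h p.1 p.2)
    -- The `ULUL` relations involve `-zw` and `1 - zw`; `z ↦ -z` turns these into `zw` and `1 + zw`.
    refine ⟨-1, 1, 2, by simp, fun p => ?_, fun u v huv => ?_, fun u v huv => ?_⟩
    · rw [(hrel (-1 * p.1, p.2)).1]
      ring
    · obtain ⟨-, -, hb⟩ := hrel (-1 * u, -v)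
      rw [hb]
      linear_combination g 3 (-1 * u, -v) * huv
    · obtain ⟨-, hc, -⟩ := hrel (-1 * u, -v)
      rw [hc]
      linear_combination g 0 (-1 * u, -v) * huv

theorem exists_mem_singularitySet {σ : Fin 4 → Shape} {g : Fin 4 → ℂ × ℂ → ℂ}
    (h : IsFactorization continuousFunctions cohnMatrix σ g) :
    ∃ p : ℂ × ℂ, (fun j => g j p) ∈ singularitySet 4 := by
  have hg (j) : Continuous (g j) := h.1 j
  obtain ⟨ε, i, j, hij, hmul, hi, hj⟩ :=
    inner_entries_of_alternating (alternating_of_isFactorization h) h.2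
  obtain ⟨p, hpi, hpj⟩ := exists_common_zero (P := fun p => g i (ε * p.1, p.2))
    (Q := fun p => g j (ε * p.1, p.2)) (by fun_prop) (by fun_prop) hmul hi hj
  refine ⟨(ε * p.1, p.2), fun k hk0 hk3 => ?_⟩
  obtain rfl | rfl : k = 1 ∨ k = 2 := by
    simp only [Fin.ext_iff]
    simp
    omega
  all_goals
    rcases hij with ⟨rfl, rfl⟩ | ⟨rfl, rfl⟩ <;> assumption

theorem IsFactorization.mono {𝓕 𝓖 : Set (ℂ × ℂ → ℂ)} (h𝓕 : 𝓕 ⊆ 𝓖)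
    {F : ℂ × ℂ → SpecialLinearGroup (Fin 2) ℂ} {N : ℕ} {σ : Fin N → Shape}
    {g : Fin N → ℂ × ℂ → ℂ} (h : IsFactorization 𝓕 F σ g) : IsFactorization 𝓖 F σ g :=
  ⟨fun j => h𝓕 (h.1 j), h.2⟩

theorem holomorphicFunctions_subset_continuousFunctions :
    holomorphicFunctions ⊆ continuousFunctions := fun _ h => h.continuous

theorem four_notMem_factorizationLengths_holomorphicFunctions :
    4 ∉ factorizationLengths holomorphicFunctions cohnMatrix := by
  rintro ⟨σ, g, h⟩
  have hg (j) : Differentiable ℂ (g j) := h.1 j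
  obtain ⟨ε, i, j, -, hmul, hi, hj⟩ := inner_entries_of_alternating
    (alternating_of_isFactorization (h.mono holomorphicFunctions_subset_continuousFunctions)) h.2
  exact not_holomorphic_of_mul_eq (P := fun p => g i (ε * p.1, p.2))
    (Q := fun p => g j (ε * p.1, p.2)) (by fun_prop) (by fun_prop) hmul hi hj

theorem five_le_of_mem_factorizationLengths {N : ℕ}
    (h : N ∈ factorizationLengths holomorphicFunctions cohnMatrix) : 5 ≤ N := by
  by_contra! hN
  exact four_notMem_factorizationLengths_holomorphicFunctions
    (factorizationLengths_of_le (differentiable_const (0 : ℂ)) (Nat.le_of_lt_succ hN) h)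

/-! ### A holomorphic factorization of length five -/

theorem exists_exp_eq_one_add_add_sq_mul :
    ∃ E : ℂ → ℂ, Differentiable ℂ E ∧ ∀ u, Complex.exp u = 1 + u + u ^ 2 * E u := by
  have hd {f : ℂ → ℂ} (hf : Differentiable ℂ f) : Differentiable ℂ (dslope f 0) := by
    rw [← differentiableOn_univ] at hf ⊢
    exact (Complex.differentiableOn_dslope Filter.univ_mem).2 hf
  refine ⟨dslope (dslope Complex.exp 0) 0, hd (hd Complex.differentiable_exp), fun u => ?_⟩
  have h1 := sub_smul_dslope Complex.exp 0 u
  have h2 := sub_smul_dslope (dslope Complex.exp 0) 0 u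
  simp only [sub_zero, smul_eq_mul, Complex.exp_zero, dslope_same, Complex.deriv_exp] at h1 h2
  linear_combination -h1 - u * h2

theorem five_mem_factorizationLengths :
    5 ∈ factorizationLengths holomorphicFunctions cohnMatrix := by
  obtain ⟨E, hE, hexp⟩ := exists_exp_eq_one_add_add_sq_mul
  -- This choice makes the upper left entry of `A L(-t)` equal to `1 + zw + z²w²E(zw) = exp(zw)`, a
  -- unit. The remaining `LULU` factorization is then solved with third entry `-1`, dividing only by
  -- `exp(zw)`.
  let t : ℂ × ℂ → ℂ := fun p => -p.2 ^ 2 * E (p.1 * p.2)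
  refine ⟨![.lower, .upper, .lower, .upper, .lower],
    ![fun p => (1 - p.2 ^ 2 - t p * (1 - p.1 * p.2)) * Complex.exp (-(p.1 * p.2)),
      fun p => 1 - Complex.exp (p.1 * p.2), fun _ => -1,
      fun p => (Complex.exp (p.1 * p.2) - 1 + p.1 ^ 2) * Complex.exp (-(p.1 * p.2)), t], ?_, ?_⟩
  · intro j
    change Differentiable ℂ _
    fin_cases j <;> simp [t] <;> fun_prop
  · intro p
    have h1 := hexp (p.1 * p.2)
    have h2 : Complex.exp (p.1 * p.2) * Complex.exp (-(p.1 * p.2)) = 1 := by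
      rw [← Complex.exp_add]; simp
    rw [elementaryProduct_five]
    simp only [Fin.isValue, cons_val]
    generalize Complex.exp (p.1 * p.2) = e at *
    generalize Complex.exp (-(p.1 * p.2)) = e' at *
    simp only [t]
    generalize E (p.1 * p.2) = c at *
    ext i j
    fin_cases i <;> fin_cases j <;>
      simp [coe_cohnMatrix, coe_elementaryMatrix_lower, coe_elementaryMatrix_upper]
    · linear_combination -h1 + p.2 ^ 2 * c * (e - 1 + p.1 ^ 2) * h2
    · linear_combination -(e - 1 + p.1 ^ 2) * h2
    · linear_combination -(1 - p.2 ^ 2 + p.2 ^ 2 * c * (1 - p.1 * p.2)) * h2 +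
        p.2 ^ 2 * c * (((e - 1 + p.1 ^ 2) * e' * (1 - p.2 ^ 2 + p.2 ^ 2 * c * (1 - p.1 * p.2)) - p.1 * p.2) * h2 -
          e' * (1 - p.1 * p.2) * h1)
    · linear_combination
        -((e - 1 + p.1 ^ 2) * e' * (1 - p.2 ^ 2 + p.2 ^ 2 * c * (1 - p.1 * p.2)) - p.1 * p.2) * h2 +
        e' * (1 - p.1 * p.2) * h1

/-! ### A continuous factorization of length four -/

/-- If `f` has norm `√‖w‖` and is continuous away from the origin, then it is continuous. -/
theorem continuous_of_norm_eq_sqrt {f : ℂ → ℂ} (hf : ∀ w, w ≠ 0 → ContinuousAt f w)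
    (hn : ∀ w, ‖f w‖ = √‖w‖) : Continuous f := by
  rw [continuous_iff_continuousAt]
  intro w
  by_cases hw : w = 0
  · subst hw
    have h0 : f 0 = 0 := by simpa using hn 0
    rw [ContinuousAt, h0, tendsto_zero_iff_norm_tendsto_zero]
    have h1 : Continuous fun w : ℂ => √‖w‖ := by fun_prop
    simpa [hn] using h1.tendsto 0
  · exact hf w hw

theorem sqrt_norm_ne_zero {w : ℂ} (hw : w ≠ 0) : ((√‖w‖ : ℝ) : ℂ) ≠ 0 := by
  simpa [Real.sqrt_eq_zero'] using hw

theorem continuous_sq_div_norm_mul_sqrt :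
    Continuous fun w : ℂ => w ^ 2 / (‖w‖ * √‖w‖ : ℝ) := by
  refine continuous_of_norm_eq_sqrt (fun w hw => ?_) fun w => ?_
  · have h1 := sqrt_norm_ne_zero hw
    refine ContinuousAt.div (by fun_prop) (by fun_prop) ?_
    push_cast
    exact mul_ne_zero (by simpa using hw) h1
  · by_cases hw : w = 0
    · simp [hw]
    · have h1 : 0 < √‖w‖ := Real.sqrt_pos.2 (norm_pos_iff.2 hw)
      rw [norm_div, norm_pow, Complex.norm_real, Real.norm_of_nonneg (by positivity)]
      nth_rewrite 1 2 [← Real.sq_sqrt (norm_nonneg w)]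
      field_simp

theorem continuous_conj_div_sqrt_norm :
    Continuous fun w : ℂ => (starRingEnd ℂ) w / (√‖w‖ : ℝ) := by
  refine continuous_of_norm_eq_sqrt (fun w hw => ?_) fun w => ?_
  · exact ContinuousAt.div (by fun_prop) (by fun_prop) (sqrt_norm_ne_zero hw)
  · rw [norm_div, Complex.norm_conj, Complex.norm_real, Real.norm_of_nonneg (by positivity),
      Real.div_sqrt]

/-- Take `ψ = w²/|w|^{3/2}`, `χ = w̄/|w|^{1/2}`, `n = |w|^{3/2}`. The common factor `ψ` of `w` and
`w²` is what cancels when solving for `y` in the length-four factorization. -/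
theorem exists_continuous_conj_splitting : ∃ ψ χ : ℂ → ℂ, ∃ n : ℂ → ℝ, Continuous ψ ∧
    Continuous χ ∧ Continuous n ∧ (∀ w, 0 ≤ n w) ∧ (∀ w, n w = 0 → w = 0) ∧
    (∀ w, ψ w * χ w = w) ∧ ∀ w, ψ w * n w = w ^ 2 := by
  refine ⟨_, _, fun w => ‖w‖ * √‖w‖, continuous_sq_div_norm_mul_sqrt,
    continuous_conj_div_sqrt_norm, by fun_prop, fun w => by positivity, fun w hw => by
      simpa [Real.sqrt_eq_zero'] using hw, fun w => ?_, fun w => ?_⟩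
  all_goals
    by_cases hw : w = 0
    · simp [hw]
    have h1 := sqrt_norm_ne_zero hw
    have h2 : ((‖w‖ : ℝ) : ℂ) ≠ 0 := by simpa using hw
  · have h3 : ((√‖w‖ : ℝ) : ℂ) ^ 2 = ‖w‖ := by
      rw [← Complex.ofReal_pow, Real.sq_sqrt (norm_nonneg w)]
    have h4 := Complex.mul_conj' w
    push_cast
    field_simp
    rw [h3]
    linear_combination h4
  · push_cast
    field_simp

theorem four_mem_factorizationLengths :
    4 ∈ factorizationLengths continuousFunctions cohnMatrix := by
  obtain ⟨ψ, χ, n, hψ, hχ, hn, hn0, hn1, hψχ, hψn⟩ := exists_continuous_conj_splitting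
  let a : ℂ × ℂ → ℂ := fun p => 1 + p.1 * p.2
  let D : ℂ × ℂ → ℂ := fun p => (n p.2 + ‖a p‖ ^ 2 : ℝ)
  -- The equation to solve is `y (ax + w²) = zw + xz²`. For this `x` the bracket is `ψD` and the
  -- right side is `ψ (zχ + z²ā)`, so `y` is a quotient by `D`. Moreover `D > 0`, since `n = 0`
  -- forces `w = 0` and then `a = 1`.
  let x : ℂ × ℂ → ℂ := fun p => ψ p.2 * (starRingEnd ℂ) (a p)
  let y : ℂ × ℂ → ℂ := fun p => (p.1 * χ p.2 + p.1 ^ 2 * (starRingEnd ℂ) (a p)) / D p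
  have ha : Continuous a := by fun_prop
  have hD0 (p) : D p ≠ 0 := by
    intro h
    have h1 : n p.2 + ‖a p‖ ^ 2 = 0 := Complex.ofReal_eq_zero.1 h
    have h2 : n p.2 = 0 := by nlinarith [hn0 p.2, sq_nonneg ‖a p‖]
    have h3 : ‖a p‖ ^ 2 = 0 := by linarith
    simp [a, hn1 _ h2] at h3
  have hD : Continuous D := by fun_prop
  have hx : Continuous x := by fun_prop
  have hy : Continuous y := Continuous.div (by fun_prop) hD hD0
  refine ⟨![.lower, .upper, .lower, .upper],
    ![x, fun p => p.1 ^ 2 - y p * a p, fun p => -p.2 ^ 2 - x p * a p, y], ?_, ?_⟩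
  · intro j
    change Continuous _
    fin_cases j <;> simp <;> fun_prop
  · intro p
    rw [elementaryProduct_four]
    refine cohnMatrix_eq_LULU ?_
    have h1 : y p * D p = p.1 * χ p.2 + p.1 ^ 2 * (starRingEnd ℂ) (a p) :=
      div_mul_cancel₀ _ (hD0 p)
    have h2 : D p = n p.2 + a p * (starRingEnd ℂ) (a p) := by
      rw [Complex.mul_conj']
      simp [D]
    have h3 : a p * x p + p.2 ^ 2 = ψ p.2 * D p := by
      rw [h2, ← hψn]
      ring
    change a p * (x p * y p) = p.1 * p.2 + x p * p.1 ^ 2 - y p * p.2 ^ 2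
    linear_combination y p * h3 + ψ p.2 * h1 + p.1 * hψχ p.2

theorem mainTheorem4 :
    IsLeast (factorizationLengths continuousFunctions cohnMatrix) 4 ∧
    IsLeast (factorizationLengths holomorphicFunctions cohnMatrix) 5 ∧
    ∀ (σ : Fin 4 → Shape) (g : Fin 4 → ℂ × ℂ → ℂ),
      IsFactorization continuousFunctions cohnMatrix σ g →
        Alternating σ ∧ ∃ p : ℂ × ℂ, (fun j => g j p) ∈ singularitySet 4 := by
  exact ⟨⟨four_mem_factorizationLengths, fun _ => four_le_of_mem_factorizationLengths⟩,
    ⟨five_mem_factorizationLengths, fun _ => five_le_of_mem_factorizationLengths⟩,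
    fun _ _ h => ⟨alternating_of_isFactorization h, exists_mem_singularitySet h⟩⟩
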